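/- Let $\mathcal C$ be a (locally small) triangulated category that has all small coproducts. Write $[n]$ for the $n$-fold shift, and for a class $\mathcal P$ of objects put $\mathcal P^{\perp}=\{Y : \mathcal C(X,Y)=0 \ \forall X\in\mathcal P\}$ and $\mathcal P[n]=\{X : X\cong Y[n] \text{ for some } Y\in\mathcal P\}$. Definitions. The class $\mathcal P$ is called (countably) perfect if the class of $\mathcal P$-null morphisms, i.e. of those $h:X\to Y$ such that $\mathcal C(M,h):\mathcal C(M,X)\to\mathcal C(M,Y)$ is zero for all $M\in\mathcal P$, is closed under small (resp. countable) coproducts. A homotopy colimit of a sequence $Y_0\xrightarrow{f_0}Y_1\xrightarrow{f_1}\cdots$ is a cone of the endomorphism of $\coprod_i Y_i$ whose restriction to $Y_i$ is the difference of the inclusion of $Y_i$ and of $f_i$ followed by the inclusion of $Y_{i+1}$. The big hull of $\mathcal P$ is the class of all retracts of homotopy colimits of sequences such that $Y_0$ and the cones of all $f_i$ are small coproducts (the empty one included) of elements of $\mathcal P$. A weight structure $w$ is a couple $(\mathcal C_{w\le 0},\mathcal C_{w\ge 0})$ of retraction-closed classes of objects such that $\mathcal C_{w\le 0}\subset\mathcal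 C_{w\le 0}[1]$, $\mathcal C_{w\ge 0}[1]\subset\mathcal C_{w\ge 0}$, $\mathcal C(X,Y)=0$ for all $X\in\mathcal C_{w\le 0}$ and $Y\in\mathcal C_{w\ge 0}[1]$, and any object $M$ fits into a distinguished triangle $L\to M\to R\to L[1]$ with $L\in\mathcal C_{w\le 0}$ and $R\in\mathcal C_{w\ge 0}[1]$. It is (countably) smashing if $\mathcal C_{w\ge 0}$ is closed under small (resp. countable) coproducts; it is perfectly generated if $\mathcal C_{w\ge 0}=\bigl(\bigcup_{i>0}\mathcal P[-i]\bigr)^{\perp}$ for some countably perfect (small) set $\mathcal P$ of objects. 1. Let $\{\mathcal P_i\}_{i\in I}$ be a (small) set of countably perfect (resp. perfect) small sets of objects of $\mathcal C$. Then the couple $(\mathcal C_{w\le 0},\mathcal C_{w\ge 0})$, where $\mathcal C_{w\le 0}$ is the big hull of $\bigcup_{i\in I,\,j\ge 0}\mathcal P_i[-j]$ and $\mathcal C_{w\ge 0}=\bigcap_{i\in I,\,j\ge 1}(\mathcal P_i^{\perp})[-j]$, is a countably smashing (resp. smashing) weight structure on $\mathcal C$. 2. Let $\{w_i\}_{i\in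 I}$ be a (small) set of perfectly generated weight structures on $\mathcal C$. Then the couple $(\mathcal C_{w\le 0},\mathcal C_{w\ge 0})$, where $\mathcal C_{w\le 0}$ is the big hull of $\bigcup_{i\in I}\mathcal C_{w_i\le 0}$ and $\mathcal C_{w\ge 0}=\bigcap_{i\in I}\mathcal C_{w_i\ge 0}$, is a weight structure on $\mathcal C$. This $w$ is perfectly generated, and it is smashing whenever all $w_i$ are smashing. -/

import Mathlib

open CategoryTheory CategoryTheory.Limits CategoryTheory.Pretriangulated

universe v u

namespace WeightStructures

section Category

variable {C : Type u} [Category.{v} C]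

/-- The closure of a class `P` of objects with respect to small coproducts: the class of all
(objects isomorphic to) coproducts of small families of elements of `P`. The empty family is
allowed, so zero objects belong to this class. -/
def coproductClosure (P : ObjectProperty C) : ObjectProperty C :=
  fun X => ∃ J : Type v, P.colimitsOfShape (Discrete J) X

/-- A class of objects is smashing if it is closed with respect to small coproducts. -/
def IsSmashingClass (P : ObjectProperty C) : Prop :=
  ∀ J : Type v, P.IsClosedUnderColimitsOfShape (Discrete J)

/-- A class of objects is countably smashing if it is closed with respect to countable
coproducts. -/
def IsCountablySmashingClass (P : ObjectProperty C) : Prop :=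
  ∀ (J : Type) [Countable J], P.IsClosedUnderColimitsOfShape (Discrete J)

end Category

variable {C : Type u} [Category.{v} C] [Preadditive C] [HasZeroObject C] [HasShift C ℤ]
  [∀ n : ℤ, (shiftFunctor C n).Additive] [Pretriangulated C]

/-- The class `P[n]` (closed under isomorphisms): the objects isomorphic to `X[n]` with
`X` in `P`. -/
def translate (P : ObjectProperty C) (n : ℤ) : ObjectProperty C :=
  P.map (shiftFunctor C n)

/-- `Z` is a cone of `f : X ⟶ Y`. -/
def IsCone {X Y : C} (f : X ⟶ Y) (Z : C) : Prop :=
  ∃ (g : Y ⟶ Z) (h : Z ⟶ X⟦(1 : ℤ)⟧), Triangle.mk f g h ∈ distTriang C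

/-- `Z` is a homotopy colimit of the sequence `Y 0 ⟶ Y 1 ⟶ ⋯`: it is a cone of the endomorphism
`id - shift` of a coproduct `D` of the objects `Y i`, that is, of the morphism whose restriction
to `Y i` is the difference of the inclusion `Y i ⟶ D` and of the composition
`Y i ⟶ Y (i + 1) ⟶ D`. -/
def IsHomotopyColimit (Y : ℕ → C) (f : ∀ i, Y i ⟶ Y (i + 1)) (Z : C) : Prop :=
  ∃ (D : Cofan Y) (hD : IsColimit D),
    IsCone (Cofan.IsColimit.desc hD fun i => D.inj i - f i ≫ D.inj (i + 1)) Z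

/-- The naive big hull of `P`: the homotopy colimits of the sequences such that `Y 0` and all the
cones of the connecting morphisms belong to the closure of `P` with respect to coproducts. -/
def naiveBigHull (P : ObjectProperty C) : ObjectProperty C :=
  fun Z => ∃ (Y : ℕ → C) (f : ∀ i, Y i ⟶ Y (i + 1)),
    coproductClosure P (Y 0) ∧
    (∀ i, ∃ K : C, IsCone (f i) K ∧ coproductClosure P K) ∧
    IsHomotopyColimit Y f Z

/-- The big hull of `P`: the retracts of the elements of the naive big hull of `P`. -/
def bigHull (P : ObjectProperty C) : ObjectProperty C :=
  (naiveBigHull P).retractClosure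

/-- The class of `P`-null morphisms: those `h : X ⟶ Y` such that the induced map from
the morphisms `M ⟶ X` to the morphisms `M ⟶ Y` is zero for all `M` in `P`. -/
def nullMorphisms (P : ObjectProperty C) : MorphismProperty C :=
  fun X _ h => ∀ M : C, P M → ∀ g : M ⟶ X, g ≫ h = 0

/-- A class of objects `P` is perfect if the class of `P`-null morphisms is closed with respect to
small coproducts. -/
def IsPerfect (P : ObjectProperty C) : Prop :=
  ∀ J : Type v, (nullMorphisms P).IsStableUnderCoproductsOfShape J

/-- A class of objects `P` is countably perfect if the class of `P`-null morphisms is closed with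
respect to countable coproducts. -/
def IsCountablyPerfect (P : ObjectProperty C) : Prop :=
  ∀ (J : Type) [Countable J], (nullMorphisms P).IsStableUnderCoproductsOfShape J

variable (C) in
/-- A weight structure (in the homological convention), given by the classes
`le` of objects of weights `≤ 0` and `ge` of objects of weights `≥ 0`. -/
structure WeightStructure where
  /-- the class of objects `w ≤ 0` -/
  le : ObjectProperty C
  /-- the class of objects `w ≥ 0` -/
  ge : ObjectProperty C
  le_retract : le.IsStableUnderRetracts
  ge_retract : ge.IsStableUnderRetracts
  le_translate : le ≤ translate le 1
  translate_ge : translate ge 1 ≤ ge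
  orthogonal : translate ge 1 ≤ le.rightOrthogonal
  exists_decomposition (M : C) : ∃ (L R : C) (f : L ⟶ M) (g : M ⟶ R) (h : R ⟶ L⟦(1 : ℤ)⟧),
    le L ∧ translate ge 1 R ∧ Triangle.mk f g h ∈ distTriang C

namespace WeightStructure

variable (w : WeightStructure C)

/-- The weight structure `w` (on a category with small coproducts) is smashing. -/
def IsSmashing : Prop := IsSmashingClass w.ge

/-- The weight structure `w` (on a category with small coproducts) is countably smashing. -/
def IsCountablySmashing : Prop := IsCountablySmashingClass w.ge

/-- The class `P` generates `w`: the class `w ≥ 0` is the right orthogonal of the union of the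
classes `P[-i]` for `i > 0`. -/
def IsGeneratedBy (P : ObjectProperty C) : Prop :=
  w.ge = (⨆ (i : ℕ) (_ : 0 < i), translate P (-(i : ℤ))).rightOrthogonal

/-- `w` is perfectly generated: it is generated by a countably perfect (small) set of objects. -/
def IsPerfectlyGenerated : Prop :=
  ∃ P : ObjectProperty C, ObjectProperty.Small.{v} P ∧ IsCountablyPerfect P ∧ w.IsGeneratedBy P

end WeightStructure

end WeightStructures

/-! Everything reduces to one essentially small, countably perfect class `P` with `P[-1]` contained
in `P`; part 1 applies this to the union of all `P_i[-j]`, `j ≥ 0`. The candidate has `P^⊥` as its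
class of weights `≥ 1`, so the main point is to decompose any `M` as `L ⟶ M ⟶ R` with `L` in the big
hull and `R` in `P^⊥` (`exists_orthogonal_decomposition`).

Killing all morphisms from `P` repeatedly gives triangles `L_i ⟶ M ⟶ X_i` in which every `M ⟶ X_i`
and `X_i ⟶ X_{i+1}` is `P`-null. Take `L` to be the homotopy colimit of the `L_i`; that of the
constant sequence is `M`. The `3 × 3` lemma makes `R` the cone of an endomorphism `φ` of `∐ X_i`.
Countable perfectness makes the shift map of `∐ X_i` and `∐ M ⟶ ∐ X_i` null, hence also `φ - 𝟙`; so
`φ` acts as the identity on morphisms from `P`, and `R` is orthogonal to `P`.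

Conversely, the big hull is left orthogonal to `P^⊥` by a Mittag-Leffler argument
(`naiveBigHull_le_leftOrthogonal`). For part 2, apply part 1 to generators of the `w_i`: the right
classes intersect as required, and the left classes are compared by orthogonality. -/

namespace WeightStructures

/-! ### Shifts of coproducts and elementary properties of distinguished triangles -/

section Shift

variable {C : Type u} [Category.{v} C] [HasShift C ℤ]

lemma shift_cofan_hom_ext {J : Type*} {X : J → C} {D : Cofan X} (hD : IsColimit D) (n : ℤ) {Y : C}
    {f g : D.pt⟦n⟧ ⟶ Y} (h : ∀ j, (D.inj j)⟦n⟧' ≫ f = (D.inj j)⟦n⟧' ≫ g) : f = g :=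
  (isColimitOfPreserves (shiftFunctor C n) hD).hom_ext fun ⟨j⟩ => h j

lemma exists_shift_cofan_desc {J : Type*} {X : J → C} {D : Cofan X} (hD : IsColimit D) (n : ℤ)
    {Y : C} (k : ∀ j, (X j)⟦n⟧ ⟶ Y) : ∃ f : D.pt⟦n⟧ ⟶ Y, ∀ j, (D.inj j)⟦n⟧' ≫ f = k j := by
  let s : Cocone (Discrete.functor X ⋙ shiftFunctor C n) :=
    { pt := Y
      ι := { app := fun j => k j.as
             naturality := by
              rintro ⟨i⟩ ⟨j⟩ f
              obtain rfl : i = j := Discrete.eq_of_hom f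
              obtain rfl : f = 𝟙 _ := Subsingleton.elim _ _
              simp } }
  exact ⟨(isColimitOfPreserves (shiftFunctor C n) hD).desc s,
    fun j => (isColimitOfPreserves (shiftFunctor C n) hD).fac s ⟨j⟩⟩

end Shift

section DistinguishedTriangles

variable {C : Type u} [Category.{v} C] [Preadditive C] [HasZeroObject C] [HasShift C ℤ]
  [∀ n : ℤ, (shiftFunctor C n).Additive] [Pretriangulated C]
  {X Y Z : C} {f : X ⟶ Y} {g : Y ⟶ Z} {h : Z ⟶ X⟦(1 : ℤ)⟧}

lemma yoneda_exact₂ (H : Triangle.mk f g h ∈ distTriang C) {W : C} (k : Y ⟶ W)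
    (hk : f ≫ k = 0) : ∃ l : Z ⟶ W, k = g ≫ l :=
  Triangle.yoneda_exact₂ _ H k hk

lemma yoneda_exact₃ (H : Triangle.mk f g h ∈ distTriang C) {W : C} (k : Z ⟶ W)
    (hk : g ≫ k = 0) : ∃ l : X⟦(1 : ℤ)⟧ ⟶ W, k = h ≫ l :=
  Triangle.yoneda_exact₃ _ H k hk

lemma yoneda_exact₁ (H : Triangle.mk f g h ∈ distTriang C) {W : C} (k : X⟦(1 : ℤ)⟧ ⟶ W)
    (hk : h ≫ k = 0) : ∃ l : Y⟦(1 : ℤ)⟧ ⟶ W, k = f⟦(1 : ℤ)⟧' ≫ l := by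
  obtain ⟨l, hl⟩ := Triangle.yoneda_exact₂ _ (rot_of_distTriang _ (rot_of_distTriang _ H)) k hk
  exact ⟨-l, by rw [hl]; exact (Preadditive.neg_comp _ _).trans (Preadditive.comp_neg _ _).symm⟩

lemma coyoneda_exact₂ (H : Triangle.mk f g h ∈ distTriang C) {W : C} (k : W ⟶ Y)
    (hk : k ≫ g = 0) : ∃ l : W ⟶ X, k = l ≫ f :=
  Triangle.coyoneda_exact₂ _ H k hk

lemma coyoneda_exact₃ (H : Triangle.mk f g h ∈ distTriang C) {W : C} (k : W ⟶ Z)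
    (hk : k ≫ h = 0) : ∃ l : W ⟶ Y, k = l ≫ g :=
  Triangle.coyoneda_exact₃ _ H k hk

lemma comp_zero₁₂ (H : Triangle.mk f g h ∈ distTriang C) : f ≫ g = 0 :=
  comp_distTriang_mor_zero₁₂ _ H

lemma comp_zero₂₃ (H : Triangle.mk f g h ∈ distTriang C) : g ≫ h = 0 :=
  comp_distTriang_mor_zero₂₃ _ H

lemma comp_zero₃₁ (H : Triangle.mk f g h ∈ distTriang C) : h ≫ f⟦(1 : ℤ)⟧' = 0 :=
  comp_distTriang_mor_zero₃₁ _ H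

lemma rotate_distinguished (H : Triangle.mk f g h ∈ distTriang C) :
    Triangle.mk g h (-f⟦(1 : ℤ)⟧') ∈ distTriang C :=
  rot_of_distTriang _ H

lemma distinguished_of_iso (H : Triangle.mk f g h ∈ distTriang C)
    {X' Y' Z' : C} {f' : X' ⟶ Y'} {g' : Y' ⟶ Z'} {h' : Z' ⟶ X'⟦(1 : ℤ)⟧}
    (e₁ : X' ≅ X) (e₂ : Y' ≅ Y) (e₃ : Z' ≅ Z) (c₁ : f' ≫ e₂.hom = e₁.hom ≫ f)
    (c₂ : g' ≫ e₃.hom = e₂.hom ≫ g) (c₃ : h' ≫ e₁.hom⟦(1 : ℤ)⟧' = e₃.hom ≫ h) :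
    Triangle.mk f' g' h' ∈ distTriang C :=
  isomorphic_distinguished _ H _ (Triangle.isoMk _ _ e₁ e₂ e₃ c₁ c₂ c₃)

/-- The cone of a morphism is unique up to isomorphism. -/
lemma exists_cone_iso (H : Triangle.mk f g h ∈ distTriang C)
    {X' Y' Z' : C} {f' : X' ⟶ Y'} {g' : Y' ⟶ Z'} {h' : Z' ⟶ X'⟦(1 : ℤ)⟧}
    (H' : Triangle.mk f' g' h' ∈ distTriang C)
    (e₁ : X ≅ X') (e₂ : Y ≅ Y') (c : f ≫ e₂.hom = e₁.hom ≫ f') : Nonempty (Z ≅ Z') :=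
  ⟨Triangle.π₃.mapIso (isoTriangleOfIso₁₂ _ _ H H' e₁ e₂ c)⟩

lemma shift_one_distinguished (H : Triangle.mk f g h ∈ distTriang C) :
    ∃ (g' : Y⟦(1 : ℤ)⟧ ⟶ Z⟦(1 : ℤ)⟧) (h' : Z⟦(1 : ℤ)⟧ ⟶ X⟦(1 : ℤ)⟧⟦(1 : ℤ)⟧),
      Triangle.mk (f⟦(1 : ℤ)⟧') g' h' ∈ distTriang C :=
  ⟨g⟦(1 : ℤ)⟧', -h⟦(1 : ℤ)⟧', distinguished_of_iso
    (rotate_distinguished (rotate_distinguished (rotate_distinguished H)))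
    (Iso.refl _) (-Iso.refl _) (Iso.refl _) (by simp) (by simp) (by simp)⟩

/-- The octahedral axiom. -/
lemma exists_octahedron [IsTriangulated C] {X₁ X₂ X₃ Z₁₂ Z₂₃ Z₁₃ : C}
    {u₁₂ : X₁ ⟶ X₂} {u₂₃ : X₂ ⟶ X₃} {u₁₃ : X₁ ⟶ X₃} (comm : u₁₂ ≫ u₂₃ = u₁₃)
    {v₁₂ : X₂ ⟶ Z₁₂} {w₁₂ : Z₁₂ ⟶ X₁⟦(1 : ℤ)⟧} (h₁₂ : Triangle.mk u₁₂ v₁₂ w₁₂ ∈ distTriang C)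
    {v₂₃ : X₃ ⟶ Z₂₃} {w₂₃ : Z₂₃ ⟶ X₂⟦(1 : ℤ)⟧} (h₂₃ : Triangle.mk u₂₃ v₂₃ w₂₃ ∈ distTriang C)
    {v₁₃ : X₃ ⟶ Z₁₃} {w₁₃ : Z₁₃ ⟶ X₁⟦(1 : ℤ)⟧} (h₁₃ : Triangle.mk u₁₃ v₁₃ w₁₃ ∈ distTriang C) :
    ∃ (m₁ : Z₁₂ ⟶ Z₁₃) (m₃ : Z₁₃ ⟶ Z₂₃), v₁₂ ≫ m₁ = u₂₃ ≫ v₁₃ ∧ m₁ ≫ w₁₃ = w₁₂ ∧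
      v₁₃ ≫ m₃ = v₂₃ ∧ w₁₃ ≫ u₁₂⟦(1 : ℤ)⟧' = m₃ ≫ w₂₃ ∧
      Triangle.mk m₁ m₃ (w₂₃ ≫ v₁₂⟦(1 : ℤ)⟧') ∈ distTriang C := by
  let o := Triangulated.someOctahedron comm h₁₂ h₂₃ h₁₃
  exact ⟨o.m₁, o.m₃, o.comm₁, o.comm₂, o.comm₃, o.comm₄, o.mem⟩

end DistinguishedTriangles

/-! ### Coproducts of triangles and the constant sequence -/

section Triangles

variable {C : Type u} [Category.{v} C] [Preadditive C] [HasZeroObject C] [HasShift C ℤ]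
  [∀ n : ℤ, (shiftFunctor C n).Additive] [Pretriangulated C]

/-- A coproduct of distinguished triangles is distinguished. -/
lemma coproduct_triangle_distinguished {J : Type*} {X₁ X₂ X₃ : J → C}
    (f : ∀ j, X₁ j ⟶ X₂ j) (g : ∀ j, X₂ j ⟶ X₃ j) (h : ∀ j, X₃ j ⟶ (X₁ j)⟦(1 : ℤ)⟧)
    (H : ∀ j, Triangle.mk (f j) (g j) (h j) ∈ distTriang C)
    {D₁ : Cofan X₁} (hD₁ : IsColimit D₁) {D₂ : Cofan X₂} (hD₂ : IsColimit D₂)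
    {D₃ : Cofan X₃} (hD₃ : IsColimit D₃)
    (F : D₁.pt ⟶ D₂.pt) (hF : ∀ j, D₁.inj j ≫ F = f j ≫ D₂.inj j)
    (G : D₂.pt ⟶ D₃.pt) (hG : ∀ j, D₂.inj j ≫ G = g j ≫ D₃.inj j)
    (K : D₃.pt ⟶ D₁.pt⟦(1 : ℤ)⟧) (hK : ∀ j, D₃.inj j ≫ K = h j ≫ (D₁.inj j)⟦(1 : ℤ)⟧') :
    Triangle.mk F G K ∈ distTriang C := by
  obtain ⟨Z, f₂, f₃, hT⟩ := distinguished_cocone_triangle F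
  have hφ : ∀ j, ∃ φ : X₃ j ⟶ Z, g j ≫ φ = D₂.inj j ≫ f₂ ∧
      h j ≫ (D₁.inj j)⟦(1 : ℤ)⟧' = φ ≫ f₃ := fun j =>
    complete_distinguished_triangle_morphism _ _ (H j) hT (D₁.inj j) (D₂.inj j) (hF j).symm
  choose φ hφ₂ hφ₃ using hφ
  let θ : D₃.pt ⟶ Z := Cofan.IsColimit.desc hD₃ φ
  have hθ : ∀ j, D₃.inj j ≫ θ = φ j := fun j => Cofan.IsColimit.fac hD₃ φ j
  have hGθ : G ≫ θ = f₂ := Cofan.IsColimit.hom_ext hD₂ _ _ fun j => by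
    rw [reassoc_of% hG j, hθ, hφ₂]
  have hKθ : K = θ ≫ f₃ := Cofan.IsColimit.hom_ext hD₃ _ _ fun j => by
    rw [hK, reassoc_of% hθ j, hφ₃]
  -- Five lemma by hand: `Hom(-, Y)` turns coproducts into products, so the termwise exact sequences
  -- can be solved index by index and the solutions assembled.
  have : IsIso θ := by
    refine isIso_of_coyoneda_map_bijective _ fun Y => ⟨?_, fun (y : D₃.pt ⟶ Y) => ?_⟩
    · intro y y' hy
      obtain ⟨d, rfl⟩ : ∃ d, y' = y - d := ⟨y - y', by abel⟩
      replace hy : θ ≫ d = 0 := by simpa using hy.symm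
      suffices d = 0 by simp [this]
      obtain ⟨k, hk⟩ := yoneda_exact₃ hT d (by
        rw [← hGθ, Category.assoc, hy, comp_zero])
      have hk' : ∀ j, ∃ l : (X₂ j)⟦(1 : ℤ)⟧ ⟶ Y, (D₁.inj j)⟦(1 : ℤ)⟧' ≫ k = (f j)⟦(1 : ℤ)⟧' ≫ l := by
        intro j
        exact yoneda_exact₁ (H j) _ (by
          rw [reassoc_of% hφ₃ j, ← hk, ← hθ, Category.assoc, hy, comp_zero])
      choose l hl using hk'
      obtain ⟨L, hL⟩ := exists_shift_cofan_desc hD₂ 1 l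
      have : k = F⟦(1 : ℤ)⟧' ≫ L := shift_cofan_hom_ext hD₁ 1 fun j => by
        rw [hl, ← hL, ← Functor.map_comp_assoc, ← Functor.map_comp_assoc, hF]
      have h0 : f₃ ≫ F⟦(1 : ℤ)⟧' = 0 := comp_zero₃₁ hT
      rw [hk, this, reassoc_of% h0, zero_comp]
    · obtain ⟨y₁, hy₁⟩ := yoneda_exact₂ hT (G ≫ y) (by
        refine Cofan.IsColimit.hom_ext hD₁ _ _ fun j => ?_
        have h0 : f j ≫ g j = 0 := comp_zero₁₂ (H j)
        rw [reassoc_of% hF, reassoc_of% hG, reassoc_of% h0, zero_comp, comp_zero])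
      have hk : ∀ j, ∃ k : (X₁ j)⟦(1 : ℤ)⟧ ⟶ Y, D₃.inj j ≫ y - φ j ≫ y₁ = h j ≫ k := fun j =>
        yoneda_exact₃ (H j) _ (by
          rw [Preadditive.comp_sub, ← reassoc_of% hG, reassoc_of% hφ₂, hy₁, sub_self])
      choose k hk using hk
      obtain ⟨k', hk'⟩ := exists_shift_cofan_desc hD₁ 1 k
      refine ⟨y₁ + f₃ ≫ k', Cofan.IsColimit.hom_ext hD₃ _ _ fun j => ?_⟩
      dsimp
      rw [reassoc_of% hθ, Preadditive.comp_add, ← reassoc_of% hφ₃, hk', ← hk]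
      abel
  exact distinguished_of_iso hT (Iso.refl _) (Iso.refl _) (asIso θ) (by simp) (by simpa using hGθ)
    (by simpa using hKθ)

/-- The splitting identifies `B` with `A ⊞ M`, so this is the biproduct triangle. -/
lemma distinguished_of_splitting {A B M : C} (f : A ⟶ B) (g : B ⟶ M) (r : B ⟶ A) (s : M ⟶ B)
    (hfr : f ≫ r = 𝟙 A) (hsg : s ≫ g = 𝟙 M) (hfg : f ≫ g = 0) (hrs : r ≫ f + g ≫ s = 𝟙 B) :
    Triangle.mk f g 0 ∈ distTriang C := by
  have hsr : s ≫ r = 0 := by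
    have h := s ≫= hrs
    simp only [Preadditive.comp_add, reassoc_of% hsg, Category.comp_id] at h
    have h' : (s ≫ r ≫ f) ≫ r = 0 := by rw [add_eq_right.mp h, zero_comp]
    simpa [hfr] using h'
  let e : B ≅ A ⊞ M :=
    { hom := biprod.lift r g
      inv := biprod.desc f s
      hom_inv_id := by simpa using hrs
      inv_hom_id := by ext <;> simp [hfr, hsg, hfg, hsr] }
  exact distinguished_of_iso (binaryBiproductTriangle_distinguished A M) (Iso.refl _) e (Iso.refl _)
    (by ext <;> simp [e, hfr, hfg]) (by simp [e]) (by simp)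

/-- An object is a homotopy colimit of the constant sequence with this value. -/
lemma constant_sequence_distinguished {M : C} {D : Cofan fun _ : ℕ => M} (hD : IsColimit D) :
    Triangle.mk (Cofan.IsColimit.desc hD fun i => D.inj i - D.inj (i + 1))
      (Cofan.IsColimit.desc hD fun _ => 𝟙 M) 0 ∈ distTriang C := by
  -- The retraction inverts `id - shift` by telescoping; the empty sum at `i = 0` leaves the zeroth
  -- copy of `M` as a complement.
  refine distinguished_of_splitting _ _
    (Cofan.IsColimit.desc hD fun i => -∑ j ∈ Finset.range i, D.inj j) (D.inj 0) ?_ ?_ ?_ ?_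
  · refine Cofan.IsColimit.hom_ext hD _ _ fun i => ?_
    simp [Finset.sum_range_succ]
  · simp
  · refine Cofan.IsColimit.hom_ext hD _ _ fun i => ?_
    simp
  · refine Cofan.IsColimit.hom_ext hD _ _ fun i => ?_
    have h := Finset.sum_range_sub (fun j => D.inj j) i
    rw [Finset.sum_sub_distrib] at h
    simp [Preadditive.sum_comp, h]

end Triangles

/-! ### Consequences of the octahedral axiom -/

section Octahedra

variable {C : Type u} [Category.{v} C] [Preadditive C] [HasZeroObject C] [HasShift C ℤ]
  [∀ n : ℤ, (shiftFunctor C n).Additive] [Pretriangulated C] [IsTriangulated C]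

/-- A variant of the `3 × 3` lemma. -/
lemma exists_triangle_of_square {A B W L N : C} {a : A ⟶ B} {b : B ⟶ W} {c : W ⟶ A⟦(1 : ℤ)⟧}
    (habc : Triangle.mk a b c ∈ distTriang C) {ψA : A ⟶ A} {ψB : B ⟶ B} (comm : ψA ≫ a = a ≫ ψB)
    {p : A ⟶ L} {q : L ⟶ A⟦(1 : ℤ)⟧} (hA : Triangle.mk ψA p q ∈ distTriang C)
    {p' : B ⟶ N} {q' : N ⟶ B⟦(1 : ℤ)⟧} (hB : Triangle.mk ψB p' q' ∈ distTriang C) :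
    ∃ φ : W ⟶ W, φ ≫ c = c ≫ ψA⟦(1 : ℤ)⟧' ∧
      ∃ (R : C) (l : L ⟶ N) (m : N ⟶ R) (n : R ⟶ L⟦(1 : ℤ)⟧) (r : W ⟶ R) (t : R ⟶ W⟦(1 : ℤ)⟧),
        Triangle.mk l m n ∈ distTriang C ∧ Triangle.mk r t (-φ⟦(1 : ℤ)⟧') ∈ distTriang C := by
  -- The cone `E` of the diagonal of the square is an extension of `W` by `L` and of `N` by `W`.
  -- Here `φ` is the composite `W ⟶ E ⟶ W`, and `R` is the cone of `L ⟶ E ⟶ N`; a third octahedron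
  -- relates them.
  obtain ⟨E, e, e', hE⟩ := distinguished_cocone_triangle (ψA ≫ a)
  obtain ⟨m₁, m₃, -, h₁, -, h₂, hm⟩ := exists_octahedron rfl hA habc hE
  obtain ⟨n₁, n₃, -, h₃, -, -, hn⟩ := exists_octahedron comm.symm habc hB hE
  obtain ⟨R, m, n, hR⟩ := distinguished_cocone_triangle (m₁ ≫ n₃)
  obtain ⟨r, t, -, -, -, -, hrt⟩ := exists_octahedron rfl hm (rotate_distinguished hn) hR
  refine ⟨n₁ ≫ m₃, by rw [Category.assoc, ← h₂, reassoc_of% h₃], R, _, m, n, r, t, hR, ?_⟩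
  simpa using hrt

/-- Given `L ⟶ M ⟶ X` and a morphism `g : X ⟶ X'` with fiber `K`, the fiber of
`M ⟶ X ⟶ X'` is an extension of `K` by `L`. -/
lemma exists_fiber_of_comp {L M X X' K : C} {a : L ⟶ M} {b : M ⟶ X} {c : X ⟶ L⟦(1 : ℤ)⟧}
    (habc : Triangle.mk a b c ∈ distTriang C) {k : K ⟶ X} {g : X ⟶ X'} {k' : X' ⟶ K⟦(1 : ℤ)⟧}
    (hg : Triangle.mk k g k' ∈ distTriang C) :
    ∃ (L' : C) (a' : L' ⟶ M) (c' : X' ⟶ L'⟦(1 : ℤ)⟧) (f : L ⟶ L') (K' : C) (_ : K ≅ K'),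
      Triangle.mk a' (b ≫ g) c' ∈ distTriang C ∧ f ≫ a' = a ∧
      c ≫ f⟦(1 : ℤ)⟧' = g ≫ c' ∧ IsCone f K' := by
  obtain ⟨L', a', c', hL'⟩ := distinguished_cocone_triangle₁ (b ≫ g)
  obtain ⟨m₁, m₃, h₁, h₂, -, -, hm⟩ := exists_octahedron rfl (rotate_distinguished habc)
    (rotate_distinguished hg) (rotate_distinguished hL')
  obtain ⟨f, rfl⟩ := (shiftFunctor C (1 : ℤ)).map_surjective m₁
  obtain ⟨K', u, w, hK'⟩ := distinguished_cocone_triangle f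
  obtain ⟨u', w', hK''⟩ := shift_one_distinguished hK'
  -- The octahedron only sees `L[1]`, `L'[1]` and `K[1]`; full faithfulness of the shift brings the
  -- isomorphism of cones back.
  obtain ⟨e⟩ := exists_cone_iso hm hK'' (Iso.refl _) (Iso.refl _) (by simp)
  refine ⟨L', a', c', f, K', (shiftFunctor C (1 : ℤ)).preimageIso e, hL', ?_, h₁, u, w, hK'⟩
  apply (shiftFunctor C (1 : ℤ)).map_injective
  simpa using h₂

end Octahedra

section CoproductClosure

variable {C : Type u} [Category.{v} C]

lemma coproductClosure_monotone {P Q : ObjectProperty C} (h : P ≤ Q) :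
    coproductClosure P ≤ coproductClosure Q := fun _ ⟨J, hX⟩ =>
  ⟨J, ObjectProperty.colimitsOfShape_monotone _ h _ hX⟩

end CoproductClosure

/-! ### Null morphisms -/

section NullMorphisms

variable {C : Type u} [Category.{v} C] [Preadditive C]

lemma nullMorphisms_comp_right {P : ObjectProperty C} {X Y Z : C} {f : X ⟶ Y}
    (hf : nullMorphisms P f) (g : Y ⟶ Z) : nullMorphisms P (f ≫ g) := fun M hM k => by
  rw [← Category.assoc, hf M hM k, zero_comp]

/-- A morphism out of a coproduct is the coproduct of its components followed by the codiagonal of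
the target. -/
lemma nullMorphisms_cofan {P : ObjectProperty C} {J : Type*}
    [(nullMorphisms P).IsStableUnderCoproductsOfShape J] [HasCoproductsOfShape J C]
    {X : J → C} {D : Cofan X} (hD : IsColimit D) {Z : C} (f : D.pt ⟶ Z)
    (hf : ∀ j, nullMorphisms P (D.inj j ≫ f)) : nullMorphisms P f := by
  have h : nullMorphisms P (Cofan.IsColimit.desc hD fun j => D.inj j ≫ f ≫
      Sigma.ι (fun _ : J => Z) j) :=
    MorphismProperty.IsStableUnderColimitsOfShape.condition _ _ D _ hD
      (coproductIsCoproduct fun _ : J => Z) (Discrete.natTrans fun j => D.inj j.as ≫ f)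
      (fun j => hf j.as) _ fun ⟨j⟩ => by
        exact (Cofan.IsColimit.fac hD (fun j => D.inj j ≫ f ≫ Sigma.ι (fun _ : J => Z) j) j).trans
          (Category.assoc _ _ _).symm
  have h' := nullMorphisms_comp_right h (Sigma.desc fun _ => 𝟙 Z)
  convert h' using 1
  refine Cofan.IsColimit.hom_ext hD _ _ fun j => ?_
  simp

lemma nullMorphisms_shift [HasShift C ℤ] [∀ n : ℤ, (shiftFunctor C n).Additive]
    {P Q : ObjectProperty C} (n : ℤ) (h : Q ≤ translate P n)
    {X Y : C} {f : X ⟶ Y} (hf : nullMorphisms P f) : nullMorphisms Q (f⟦n⟧') := by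
  intro M hM k
  obtain ⟨N, hN, ⟨e⟩⟩ := h M hM
  obtain ⟨k', hk'⟩ := (shiftFunctor C n).map_surjective (e.hom ≫ k)
  rw [← cancel_epi e.hom, ← Category.assoc, ← hk', ← Functor.map_comp, hf N hN, Functor.map_zero,
    comp_zero]

end NullMorphisms

/-! ### Approximation by a tower of null triangles -/

section Approximation

variable {C : Type u} [Category.{v} C] [Preadditive C] [HasZeroObject C] [HasShift C ℤ]
  [∀ n : ℤ, (shiftFunctor C n).Additive] [Pretriangulated C]

/-- Take the coproduct of the sources of all morphisms to `M` from representatives of `P`: every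
morphism from `P` to `M` factors through it, hence dies in the cone. -/
lemma exists_null_cone [HasCoproducts.{v} C] (P : ObjectProperty C)
    [ObjectProperty.EssentiallySmall.{v} P] (M : C) :
    ∃ (K X : C) (k : K ⟶ M) (g : M ⟶ X) (h : X ⟶ K⟦(1 : ℤ)⟧), coproductClosure P K ∧
      nullMorphisms P g ∧ Triangle.mk k g h ∈ distTriang C := by
  obtain ⟨P₀, _, hP₀, hP⟩ := ObjectProperty.EssentiallySmall.exists_small_le.{v} P
  let J := Σ s : Shrink.{v} (Subtype P₀), (((equivShrink (Subtype P₀)).symm s).1 ⟶ M)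
  let F : J → C := fun j => ((equivShrink (Subtype P₀)).symm j.1).1
  obtain ⟨X, g, h, H⟩ := distinguished_cocone_triangle (Sigma.desc (f := F) fun j => j.2)
  refine ⟨∐ F, X, _, g, h, ⟨J, ⟨.colimit (Discrete.functor F) fun j => hP₀ _ ?_⟩⟩, ?_, H⟩
  · exact ((equivShrink (Subtype P₀)).symm j.as.1).2
  · intro N hN k
    obtain ⟨N', hN', ⟨e⟩⟩ := hP N hN
    let j : J := ⟨equivShrink (Subtype P₀) ⟨N', hN'⟩,
      eqToHom (by rw [Equiv.symm_apply_apply]) ≫ e.inv ≫ k⟩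
    have : k = (e.hom ≫ eqToHom (by simp [F, j]) ≫ Sigma.ι F j) ≫
        Sigma.desc (f := F) fun j => j.2 := by
      simp [j]
    rw [this, Category.assoc, comp_zero₁₂ H, comp_zero]

/-- A distinguished triangle `L ⟶ M ⟶ X ⟶ L[1]` such that `M ⟶ X` is a `P`-null morphism. -/
structure NullTriangle (P : ObjectProperty C) (M : C) where
  /-- the first object -/
  L : C
  /-- the third object -/
  X : C
  /-- the first morphism -/
  a : L ⟶ M
  /-- the second morphism -/
  b : M ⟶ X
  /-- the third morphism -/
  c : X ⟶ L⟦(1 : ℤ)⟧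
  distinguished : Triangle.mk a b c ∈ distTriang C
  null : nullMorphisms P b

/-- Morphisms from `P` are killed again, now in `X`; the octahedron shows that `L` grows by a
coproduct of elements of `P`, as the big hull demands. -/
lemma NullTriangle.exists_next [HasCoproducts.{v} C] [IsTriangulated C] {P : ObjectProperty C}
    [ObjectProperty.EssentiallySmall.{v} P] {M : C} (T : NullTriangle P M) :
    ∃ (T' : NullTriangle P M) (f : T.L ⟶ T'.L) (g : T.X ⟶ T'.X),
      f ≫ T'.a = T.a ∧ T.c ≫ f⟦(1 : ℤ)⟧' = g ≫ T'.c ∧ nullMorphisms P g ∧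
      ∃ K : C, IsCone f K ∧ coproductClosure P K := by
  obtain ⟨K, X', k, g, h, ⟨J, hK⟩, hg, H⟩ := exists_null_cone P T.X
  obtain ⟨L', a', c', f, K', e, H', h₁, h₂, h₃⟩ := exists_fiber_of_comp T.distinguished H
  exact ⟨⟨L', X', a', T.b ≫ g, c', H', nullMorphisms_comp_right T.null g⟩, f, g, h₁, h₂, hg, K',
    h₃, J, (P.colimitsOfShape (Discrete J)).prop_of_iso e hK⟩

lemma exists_null_tower [HasCoproducts.{v} C] [IsTriangulated C] (P : ObjectProperty C)
    [ObjectProperty.EssentiallySmall.{v} P] (M : C) :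
    ∃ (T : ℕ → NullTriangle P M) (f : ∀ i, (T i).L ⟶ (T (i + 1)).L)
      (g : ∀ i, (T i).X ⟶ (T (i + 1)).X), coproductClosure P (T 0).L ∧
      ∀ i, f i ≫ (T (i + 1)).a = (T i).a ∧ (T i).c ≫ (f i)⟦(1 : ℤ)⟧' = g i ≫ (T (i + 1)).c ∧
        nullMorphisms P (g i) ∧ ∃ K : C, IsCone (f i) K ∧ coproductClosure P K := by
  obtain ⟨K, X, k, g, h, hK, hg, H⟩ := exists_null_cone P M
  choose next f g h using fun T : NullTriangle P M => T.exists_next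
  let T : ℕ → NullTriangle P M := fun n =>
    Nat.rec ⟨K, X, k, _, _, H, hg⟩ (fun _ T => next T) n
  exact ⟨T, fun i => f (T i), fun i => g (T i), hK, fun i => h (T i)⟩

/-- Any object `M` is an extension of an object right orthogonal to `P` by an element of the
big hull of `P`. -/
theorem exists_orthogonal_decomposition [HasCoproducts.{v} C] [IsTriangulated C]
    (P : ObjectProperty C) [ObjectProperty.EssentiallySmall.{v} P] (hP : IsCountablyPerfect P)
    (hP' : P ≤ translate P 1) (M : C) :
    ∃ (L R : C) (f : L ⟶ M) (g : M ⟶ R) (h : R ⟶ L⟦(1 : ℤ)⟧),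
      naiveBigHull P L ∧ P.rightOrthogonal R ∧ Triangle.mk f g h ∈ distTriang C := by
  obtain ⟨T, f, g, h₀, h⟩ := exists_null_tower P M
  choose h₁ h₂ h₃ h₄ using h
  have := hasCoproducts_shrink.{0, v} (C := C)
  have := hP ℕ
  let D₁ : Cofan fun i => (T i).L := Cofan.mk _ (Sigma.ι fun i => (T i).L)
  have hD₁ : IsColimit D₁ := coproductIsCoproduct _
  let D₂ : Cofan fun _ : ℕ => M := Cofan.mk _ (Sigma.ι fun _ : ℕ => M)
  have hD₂ : IsColimit D₂ := coproductIsCoproduct _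
  let D₃ : Cofan fun i => (T i).X := Cofan.mk _ (Sigma.ι fun i => (T i).X)
  have hD₃ : IsColimit D₃ := coproductIsCoproduct _
  let a : D₁.pt ⟶ D₂.pt := Cofan.IsColimit.desc hD₁ fun i => (T i).a ≫ D₂.inj i
  let b : D₂.pt ⟶ D₃.pt := Cofan.IsColimit.desc hD₂ fun i => (T i).b ≫ D₃.inj i
  let c : D₃.pt ⟶ D₁.pt⟦(1 : ℤ)⟧ := Cofan.IsColimit.desc hD₃ fun i =>
    (T i).c ≫ (D₁.inj i)⟦(1 : ℤ)⟧'
  have ha : ∀ i, D₁.inj i ≫ a = (T i).a ≫ D₂.inj i := fun i => Cofan.IsColimit.fac hD₁ _ i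
  have hb : ∀ i, D₂.inj i ≫ b = (T i).b ≫ D₃.inj i := fun i => Cofan.IsColimit.fac hD₂ _ i
  have hc : ∀ i, D₃.inj i ≫ c = (T i).c ≫ (D₁.inj i)⟦(1 : ℤ)⟧' := fun i =>
    Cofan.IsColimit.fac hD₃ _ i
  have habc : Triangle.mk a b c ∈ distTriang C :=
    coproduct_triangle_distinguished _ _ _ (fun i => (T i).distinguished) hD₁ hD₂ hD₃
      a ha b hb c hc
  have hb₀ : nullMorphisms P b := nullMorphisms_cofan hD₂ b fun i => by
    rw [hb]
    exact nullMorphisms_comp_right (T i).null _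
  let s : D₃.pt ⟶ D₃.pt := Cofan.IsColimit.desc hD₃ fun i => g i ≫ D₃.inj (i + 1)
  have hs : ∀ i, D₃.inj i ≫ s = g i ≫ D₃.inj (i + 1) := fun i => Cofan.IsColimit.fac hD₃ _ i
  have hs₀ : nullMorphisms P s := nullMorphisms_cofan hD₃ s fun i => by
    rw [hs]
    exact nullMorphisms_comp_right (h₃ i) _
  let ψ := Cofan.IsColimit.desc hD₁ fun i => D₁.inj i - f i ≫ D₁.inj (i + 1)
  have hψ : ∀ i, D₁.inj i ≫ ψ = D₁.inj i - f i ≫ D₁.inj (i + 1) := fun i =>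
    Cofan.IsColimit.fac hD₁ _ i
  let ψ' := Cofan.IsColimit.desc hD₂ fun i => D₂.inj i - D₂.inj (i + 1)
  have hψ' : ∀ i, D₂.inj i ≫ ψ' = D₂.inj i - D₂.inj (i + 1) := fun i =>
    Cofan.IsColimit.fac hD₂ _ i
  obtain ⟨L, p, q, hL⟩ := distinguished_cocone_triangle ψ
  obtain ⟨φ, hφ, R, l, m, n, r, t, hLMR, hR⟩ := exists_triangle_of_square habc
    (ψA := ψ) (ψB := ψ') (Cofan.IsColimit.hom_ext hD₁ _ _ fun i => by
      rw [reassoc_of% hψ, reassoc_of% ha, hψ', Preadditive.sub_comp, Preadditive.comp_sub, ha,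
        Category.assoc, ha, reassoc_of% h₁]) hL (constant_sequence_distinguished hD₂)
  have hcψ : c ≫ ψ⟦(1 : ℤ)⟧' = (𝟙 _ - s) ≫ c := Cofan.IsColimit.hom_ext hD₃ _ _ fun i => by
    rw [reassoc_of% hc, ← Functor.map_comp, hψ, Preadditive.sub_comp, Preadditive.comp_sub,
      reassoc_of% hs, Category.id_comp, hc, hc, Functor.map_sub, Functor.map_comp,
      Preadditive.comp_sub, reassoc_of% h₂]
  -- The filler `φ` need not be `𝟙 - s`, but the two agree after composing with `c`. As `s` is null,
  -- `x ≫ (φ - 𝟙)` is killed by `c` and so factors through the null morphism `b`.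
  have hφ₀ : nullMorphisms P (φ - 𝟙 _) := by
    intro N hN x
    obtain ⟨y, hy⟩ := coyoneda_exact₃ habc (x ≫ (φ - 𝟙 _)) (by
      rw [Category.assoc, Preadditive.sub_comp, hφ, hcψ, Preadditive.sub_comp, sub_sub_cancel_left,
        Preadditive.comp_neg, reassoc_of% hs₀ N hN x, zero_comp, neg_zero])
    rw [hy, hb₀ N hN]
  refine ⟨L, R, l, m, n, ⟨_, f, h₀, h₄, D₁, hD₁, p, q, hL⟩, ?_, hLMR⟩
  intro N x hN
  -- The inclusion of `P` in `P[1]` is needed here: `φ[1]` must also act as the identity on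
  -- morphisms from `P`. Then `x ≫ t`, killed by `φ[1]`, vanishes.
  have hφ₁ := nullMorphisms_shift 1 hP' hφ₀
  have hxt : x ≫ t = 0 := by
    have h := hφ₁ N hN (x ≫ t)
    have h' := comp_zero₂₃ hR
    rw [Preadditive.comp_neg, neg_eq_zero] at h'
    rw [Functor.map_sub, CategoryTheory.Functor.map_id, Preadditive.comp_sub, Category.assoc, h'] at h
    simpa using h
  obtain ⟨y, hy⟩ := coyoneda_exact₂ hR x hxt
  have hφr : φ ≫ r = 0 := by
    apply (shiftFunctor C (1 : ℤ)).map_injective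
    simpa using comp_zero₃₁ hR
  -- Now `x = y ≫ r` and `y = y ≫ φ`, while `φ ≫ r = 0`.
  have h := hφ₀ N hN y
  rw [Preadditive.comp_sub, Category.comp_id, sub_eq_zero] at h
  rw [hy, ← h, Category.assoc, hφr, comp_zero]

end Approximation

/-! ### Orthogonality and the big hull -/

section Orthogonality

variable {C : Type u} [Category.{v} C] [Preadditive C]

lemma coproductClosure_le_leftOrthogonal (P : ObjectProperty C) :
    coproductClosure P ≤ P.rightOrthogonal.leftOrthogonal := by
  rintro X ⟨J, ⟨hX⟩⟩ Y f hY
  exact hX.isColimit.hom_ext fun j => by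
    rw [comp_zero]
    exact hY _ (hX.prop_diag_obj j)

lemma isStableUnderRetracts_leftOrthogonal (P : ObjectProperty C) :
    P.leftOrthogonal.IsStableUnderRetracts where
  of_retract r h Y f hY := by
    have := h (r.r ≫ f) hY
    rw [← Category.id_comp f, ← r.retract, Category.assoc, this, comp_zero]

lemma isStableUnderRetracts_rightOrthogonal (P : ObjectProperty C) :
    P.rightOrthogonal.IsStableUnderRetracts where
  of_retract r h Y f hY := by
    have := h (f ≫ r.i) hY
    rw [← Category.comp_id f, ← r.retract, ← Category.assoc, this, zero_comp]

end Orthogonality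

section BigHull

variable {C : Type u} [Category.{v} C] [Preadditive C] [HasZeroObject C] [HasShift C ℤ]
  [∀ n : ℤ, (shiftFunctor C n).Additive] [Pretriangulated C]

/-- For `W` in `P^⊥`, the groups `Hom(Y_i, W)` vanish by induction, and the maps `Hom(Y_{i+1}[1], W)
⟶ Hom(Y_i[1], W)` are onto. Surjectivity kills the `lim¹` term, which is all that could remain of
`Hom(Z, W)`. -/
lemma naiveBigHull_le_leftOrthogonal (P : ObjectProperty C) :
    naiveBigHull P ≤ P.rightOrthogonal.leftOrthogonal := by
  rintro Z ⟨Y, f, h₀, hf, D, hD, p, q, hZ⟩ W x hW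
  have hY : ∀ i (y : Y i ⟶ W), y = 0 := by
    intro i
    induction i with
    | zero => exact fun y => coproductClosure_le_leftOrthogonal P _ h₀ y hW
    | succ i hi =>
      intro y
      obtain ⟨K, ⟨g, h, H⟩, hK⟩ := hf i
      obtain ⟨l, rfl⟩ := yoneda_exact₂ H y (hi _)
      rw [coproductClosure_le_leftOrthogonal P _ hK l hW, comp_zero]
  have hY' : ∀ i (y : (Y i)⟦(1 : ℤ)⟧ ⟶ W), ∃ z : (Y (i + 1))⟦(1 : ℤ)⟧ ⟶ W,
      y = (f i)⟦(1 : ℤ)⟧' ≫ z := by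
    intro i y
    obtain ⟨K, ⟨g, h, H⟩, hK⟩ := hf i
    exact yoneda_exact₁ H y (coproductClosure_le_leftOrthogonal P _ hK _ hW)
  choose e he using hY'
  obtain ⟨y, rfl⟩ := yoneda_exact₃ hZ x (Cofan.IsColimit.hom_ext hD _ _ fun i => by
    rw [hY i (D.inj i ≫ p ≫ x), comp_zero])
  -- Solve `y = (id - shift)[1] ≫ z'` one component at a time: start from `0` and lift along `f i`
  -- at each stage.
  let z : ∀ i, (Y i)⟦(1 : ℤ)⟧ ⟶ W := fun i =>
    Nat.rec 0 (fun i z => e i (z - (D.inj i)⟦(1 : ℤ)⟧' ≫ y)) i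
  have hz : ∀ i, (f i)⟦(1 : ℤ)⟧' ≫ z (i + 1) = z i - (D.inj i)⟦(1 : ℤ)⟧' ≫ y := fun i =>
    (he i _).symm
  obtain ⟨z', hz'⟩ := exists_shift_cofan_desc hD 1 z
  have : y = (Cofan.IsColimit.desc hD fun i => D.inj i - f i ≫ D.inj (i + 1))⟦(1 : ℤ)⟧' ≫ z' :=
    shift_cofan_hom_ext hD 1 fun i => by
      rw [← Functor.map_comp_assoc, Cofan.IsColimit.fac, Functor.map_sub, Preadditive.sub_comp,
        Functor.map_comp, Category.assoc, hz', hz', hz, sub_sub_cancel]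
  rw [this, reassoc_of% comp_zero₃₁ hZ, zero_comp]

lemma bigHull_le_leftOrthogonal (P : ObjectProperty C) :
    bigHull P ≤ P.rightOrthogonal.leftOrthogonal := by
  have := isStableUnderRetracts_leftOrthogonal P.rightOrthogonal
  exact (ObjectProperty.retractClosure_le_iff _ _).2 (naiveBigHull_le_leftOrthogonal P)

lemma bigHull_monotone {P Q : ObjectProperty C} (h : P ≤ Q) : bigHull P ≤ bigHull Q :=
  ObjectProperty.monotone_retractClosure fun _ ⟨Y, f, h₀, hf, hZ⟩ =>
    ⟨Y, f, coproductClosure_monotone h _ h₀, fun i => by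
      obtain ⟨K, hK, hK'⟩ := hf i
      exact ⟨K, hK, coproductClosure_monotone h _ hK'⟩, hZ⟩

lemma retract_of_zero {L M R : C} {f : L ⟶ M} {g : M ⟶ R} {h : R ⟶ L⟦(1 : ℤ)⟧}
    (H : Triangle.mk f g h ∈ distTriang C) (hg : g = 0) : Nonempty (Retract M L) := by
  obtain ⟨s, hs⟩ := coyoneda_exact₂ H (𝟙 M) (by rw [hg, comp_zero])
  exact ⟨⟨s, f, hs.symm⟩⟩

/-- If `X` is left orthogonal to `w.ge[1]`, the second morphism of its weight decomposition is zero,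
so `X` is a retract of the first term. -/
lemma WeightStructure.le_eq_leftOrthogonal (w : WeightStructure C) :
    w.le = (translate w.ge 1).leftOrthogonal := by
  refine le_antisymm (fun X hX Y f hY => w.orthogonal Y hY f hX) fun X hX => ?_
  obtain ⟨L, R, f, g, h, hL, hR, H⟩ := w.exists_decomposition X
  obtain ⟨r⟩ := retract_of_zero H (hX g hR)
  exact w.le_retract.of_retract r hL

lemma bigHull_eq_leftOrthogonal [HasCoproducts.{v} C] [IsTriangulated C]
    (P : ObjectProperty C) [ObjectProperty.EssentiallySmall.{v} P] (hP : IsCountablyPerfect P)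
    (hP' : P ≤ translate P 1) : bigHull P = P.rightOrthogonal.leftOrthogonal := by
  refine le_antisymm (bigHull_le_leftOrthogonal P) fun X hX => ?_
  obtain ⟨L, R, f, g, h, hL, hR, H⟩ := exists_orthogonal_decomposition P hP hP' X
  obtain ⟨r⟩ := retract_of_zero H (hX g hR)
  exact ⟨L, hL, ⟨r⟩⟩

end BigHull

section IntersectionClosed

variable {C : Type u} [Category.{v} C]

lemma isClosedUnderColimitsOfShape_iInf {ι : Sort*} {J : Type*} [Category* J]
    {P : ι → ObjectProperty C}
    (hP : ∀ i, (P i).IsClosedUnderColimitsOfShape J) :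
    (⨅ i, P i).IsClosedUnderColimitsOfShape J where
  colimitsOfShape_le := le_iInf fun i =>
    (ObjectProperty.colimitsOfShape_monotone _ (iInf_le P i)).trans
      (hP i).colimitsOfShape_le

end IntersectionClosed

/-! ### Translates and families of classes -/

section Translate

variable {C : Type u} [Category.{v} C] [HasShift C ℤ]

lemma translate_monotone {P Q : ObjectProperty C} (h : P ≤ Q) (n : ℤ) :
    translate P n ≤ translate Q n :=
  ObjectProperty.map_monotone h _

lemma translate_translate (P : ObjectProperty C) (m n : ℤ) :
    translate (translate P m) n = translate P (m + n) := by
  ext X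
  constructor
  · rintro ⟨Y, ⟨Z, hZ, ⟨e⟩⟩, ⟨e'⟩⟩
    exact ⟨Z, hZ, ⟨(shiftFunctorAdd C m n).app Z ≪≫ (shiftFunctor C n).mapIso e ≪≫ e'⟩⟩
  · rintro ⟨Z, hZ, ⟨e⟩⟩
    exact ⟨Z⟦m⟧, ObjectProperty.prop_map_obj _ _ hZ, ⟨(shiftFunctorAdd C m n).symm.app Z ≪≫ e⟩⟩

lemma translate_zero (P : ObjectProperty C) : translate P 0 = P.isoClosure := by
  ext X
  exact ⟨fun ⟨Z, hZ, ⟨e⟩⟩ => ⟨Z, hZ, ⟨e.symm ≪≫ (shiftFunctorZero C ℤ).app Z⟩⟩,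
    fun ⟨Z, hZ, ⟨e⟩⟩ => ⟨Z, hZ, ⟨(shiftFunctorZero C ℤ).app Z ≪≫ e.symm⟩⟩⟩

lemma translate_neg_translate (P : ObjectProperty C) [P.IsClosedUnderIsomorphisms] {m n : ℤ}
    (h : m + n = 0) : translate (translate P m) n = P := by
  rw [translate_translate, h, translate_zero, ObjectProperty.isoClosure_eq_self]

lemma translate_iSup {ι : Sort*} (P : ι → ObjectProperty C) (n : ℤ) :
    translate (⨆ i, P i) n = ⨆ i, translate (P i) n := by
  ext X
  simp only [iSup_apply, iSup_Prop_eq, translate, ObjectProperty.prop_map_iff]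
  constructor
  · rintro ⟨Y, ⟨i, hY⟩, e⟩
    exact ⟨i, Y, hY, e⟩
  · rintro ⟨i, Y, hY, e⟩
    exact ⟨Y, ⟨i, hY⟩, e⟩

instance (P : ObjectProperty C) [ObjectProperty.EssentiallySmall.{v} P] (n : ℤ) :
    ObjectProperty.EssentiallySmall.{v} (translate P n) :=
  inferInstanceAs (ObjectProperty.EssentiallySmall.{v} (P.map (shiftFunctor C n)))

/-- The class `⋃ P_i[-j]`, where `i` is an index and `j` is a natural number. -/
abbrev negativeTranslates {ι : Type*} (P : ι → ObjectProperty C) : ObjectProperty C :=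
  ⨆ (i : ι) (j : ℕ), translate (P i) (-(j : ℤ))

lemma le_negativeTranslates {ι : Type*} (P : ι → ObjectProperty C) (i : ι) (j : ℕ) :
    translate (P i) (-(j : ℤ)) ≤ negativeTranslates P :=
  le_iSup_of_le i (le_iSup (fun j : ℕ => translate (P i) (-(j : ℤ))) j)

lemma negativeTranslates_le_translate {ι : Type*} (P : ι → ObjectProperty C) :
    negativeTranslates P ≤ translate (negativeTranslates P) 1 :=
  iSup_le fun i => iSup_le fun j => by
    have h := translate_monotone (le_negativeTranslates P i (j + 1)) 1
    rw [translate_translate] at h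
    simpa using h

end Translate

section Families

variable {C : Type u} [Category.{v} C] [Preadditive C]

lemma rightOrthogonal_iSup {ι : Sort*} (P : ι → ObjectProperty C) :
    (⨆ i, P i).rightOrthogonal = ⨅ i, (P i).rightOrthogonal := by
  ext X
  simp only [iInf_apply, iInf_Prop_eq, ObjectProperty.rightOrthogonal_iff, iSup_apply,
    iSup_Prop_eq]
  exact ⟨fun h i Y f hY => h f ⟨i, hY⟩, fun h Y f ⟨i, hY⟩ => h i f hY⟩

lemma isStableUnderCoproducts_nullMorphisms_iSup {ι : Sort*} {P : ι → ObjectProperty C}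
    {J : Type*} (hP : ∀ i, (nullMorphisms (P i)).IsStableUnderCoproductsOfShape J) :
    (nullMorphisms (⨆ i, P i)).IsStableUnderCoproductsOfShape J where
  condition X₁ X₂ c₁ c₂ h₁ h₂ f hf φ hφ := by
    have hle : ∀ i, nullMorphisms (⨆ i, P i) ≤ nullMorphisms (P i) := fun i X Y g hg M hM k =>
      hg M (le_iSup P i M hM) k
    intro M hM k
    rw [iSup_apply, iSup_Prop_eq] at hM
    obtain ⟨i, hM⟩ := hM
    exact (hP i).condition X₁ X₂ c₁ c₂ h₁ h₂ f (fun j => hle i _ (hf j)) φ hφ M hM k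

lemma IsPerfect.isCountablyPerfect {P : ObjectProperty C} (hP : IsPerfect P) :
    IsCountablyPerfect P := fun J _ => by
  have := hP (ULift.{v} J)
  refine (MorphismProperty.isStableUnderColimitsOfShape_iff_colimitsOfShape_le _ _).2 ?_
  rw [← MorphismProperty.colimitsOfShape_eq_of_equivalence _
    (Discrete.equivalence (Equiv.ulift.{v} (α := J)))]
  exact MorphismProperty.colimitsOfShape_le

/-- An object is right orthogonal to `P` exactly when its identity is `P`-null, and a coproduct of
identities is an identity. -/
lemma isClosedUnderCoproducts_rightOrthogonal {P : ObjectProperty C} {J : Type*}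
    (hP : (nullMorphisms P).IsStableUnderCoproductsOfShape J) :
    P.rightOrthogonal.IsClosedUnderColimitsOfShape (Discrete J) where
  colimitsOfShape_le := by
    rintro X ⟨hX⟩ M k hM
    simpa using hP.condition hX.diag hX.diag _ _ hX.isColimit hX.isColimit (𝟙 _)
      (fun j N hN l => hX.prop_diag_obj j _ hN) (𝟙 _) (fun j => by simp) M hM k

end Families

section TranslateAdditive

variable {C : Type u} [Category.{v} C] [Preadditive C] [HasShift C ℤ]
  [∀ n : ℤ, (shiftFunctor C n).Additive]

lemma translate_rightOrthogonal (P : ObjectProperty C) (n : ℤ) :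
    translate P.rightOrthogonal n = (translate P n).rightOrthogonal := by
  have h : ∀ (P : ObjectProperty C) (n : ℤ),
      translate P.rightOrthogonal n ≤ (translate P n).rightOrthogonal := by
    rintro P n Y ⟨Y', hY', ⟨e⟩⟩ X f ⟨X', hX', ⟨e'⟩⟩
    obtain ⟨g, hg⟩ := (shiftFunctor C n).map_surjective (e'.hom ≫ f ≫ e.inv)
    rw [← cancel_mono e.inv, ← cancel_epi e'.hom, ← hg, hY' g hX']
    simp
  refine le_antisymm (h P n) ?_
  -- The reverse inclusion is `h` for `translate P n` and `-n`, shifted back by `n`.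
  have h' := translate_monotone (h (translate P n) (-n)) n
  rw [translate_neg_translate _ (by simp), translate_translate, add_neg_cancel,
    translate_zero] at h'
  refine h'.trans (translate_monotone (fun Y hY X f hX => hY f ?_) n)
  exact P.le_isoClosure _ hX

lemma translate_rightOrthogonal_le {P : ObjectProperty C} {n : ℤ} (h : P ≤ translate P n) :
    translate P.rightOrthogonal n ≤ P.rightOrthogonal := by
  rw [translate_rightOrthogonal]
  exact fun Y hY X f hX => hY f (h X hX)

lemma nullMorphisms_translate_iff (P : ObjectProperty C) (n : ℤ) {X Y : C} (f : X ⟶ Y) :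
    nullMorphisms (translate P n) f ↔ nullMorphisms P (f⟦-n⟧') := by
  constructor
  · refine nullMorphisms_shift (-n) ?_
    rw [translate_translate, add_neg_cancel, translate_zero]
    exact P.le_isoClosure
  · intro hf M hM k
    have hM' : P.isoClosure (M⟦-n⟧) := by
      have := ObjectProperty.prop_map_obj _ (shiftFunctor C (-n)) hM
      rwa [← translate, translate_translate, add_neg_cancel, translate_zero] at this
    obtain ⟨N, hN, ⟨e⟩⟩ := hM'
    apply (shiftFunctor C (-n)).map_injective
    rw [← cancel_epi e.inv, Functor.map_comp, ← Category.assoc, hf N hN, Functor.map_zero,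
      comp_zero]

lemma isStableUnderCoproducts_nullMorphisms_translate {P : ObjectProperty C} {J : Type*}
    (hP : (nullMorphisms P).IsStableUnderCoproductsOfShape J) (n : ℤ) :
    (nullMorphisms (translate P n)).IsStableUnderCoproductsOfShape J where
  condition X₁ X₂ c₁ c₂ h₁ h₂ f hf φ hφ := by
    rw [nullMorphisms_translate_iff]
    exact hP.condition _ _ _ _ (isColimitOfPreserves (shiftFunctor C (-n)) h₁)
      (isColimitOfPreserves (shiftFunctor C (-n)) h₂) (Functor.whiskerRight f _)
      (fun j => (nullMorphisms_translate_iff P n _).1 (hf j)) _ (fun j => by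
        simp only [Functor.mapCocone_ι_app, Functor.whiskerRight_app, Functor.mapCocone_pt]
        rw [← Functor.map_comp, hφ, Functor.map_comp])

lemma translate_negativeTranslates_rightOrthogonal {ι : Type*} (P : ι → ObjectProperty C) :
    translate (negativeTranslates P).rightOrthogonal (-1) =
      ⨅ (i : ι) (j : ℕ) (_ : 1 ≤ j), translate (P i).rightOrthogonal (-(j : ℤ)) := by
  rw [translate_rightOrthogonal]
  simp only [translate_iSup, rightOrthogonal_iSup, translate_rightOrthogonal, translate_translate]
  refine iInf_congr fun i => le_antisymm ?_ ?_
  · refine le_iInf fun j => le_iInf fun hj => ?_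
    obtain ⟨j, rfl⟩ := Nat.exists_eq_add_of_le' hj
    refine iInf_le_of_le j (le_of_eq ?_)
    congr 2
    push_cast
    ring
  · refine le_iInf fun j => iInf_le_of_le (j + 1) (iInf_le_of_le (by simp) (le_of_eq ?_))
    congr 2
    push_cast
    ring

lemma isClosedUnderCoproducts_iInf_translate {ι : Type*} {P : ι → ObjectProperty C} {J : Type*}
    (hP : ∀ i, (nullMorphisms (P i)).IsStableUnderCoproductsOfShape J) :
    (⨅ (i : ι) (j : ℕ) (_ : 1 ≤ j),
      translate (P i).rightOrthogonal (-(j : ℤ))).IsClosedUnderColimitsOfShape (Discrete J) :=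
  isClosedUnderColimitsOfShape_iInf fun i => isClosedUnderColimitsOfShape_iInf fun j =>
    isClosedUnderColimitsOfShape_iInf fun _ => by
      rw [translate_rightOrthogonal]
      exact isClosedUnderCoproducts_rightOrthogonal
        (isStableUnderCoproducts_nullMorphisms_translate (hP i) _)

end TranslateAdditive

/-! ### Generated weight structures and the main results -/

section Generation

variable {C : Type u} [Category.{v} C] [Preadditive C] [HasZeroObject C] [HasShift C ℤ]
  [∀ n : ℤ, (shiftFunctor C n).Additive] [Pretriangulated C]

lemma WeightStructure.IsGeneratedBy.ge_eq {w : WeightStructure C} {P : ObjectProperty C}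
    (h : w.IsGeneratedBy P) :
    w.ge = ⨅ (j : ℕ) (_ : 1 ≤ j), translate P.rightOrthogonal (-(j : ℤ)) := by
  rw [WeightStructure.IsGeneratedBy] at h
  simp only [h, rightOrthogonal_iSup, translate_rightOrthogonal]
  rfl

lemma WeightStructure.IsGeneratedBy.translate_le {w : WeightStructure C} {P : ObjectProperty C}
    (h : w.IsGeneratedBy P) (j : ℕ) : translate P (-(j : ℤ)) ≤ w.le := by
  have h' : translate w.ge 1 ≤ (translate P (-(j : ℤ))).rightOrthogonal := by
    have h₁ : w.ge ≤ translate P.rightOrthogonal (-((j + 1 : ℕ) : ℤ)) := by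
      rw [h.ge_eq]
      -- Index `j + 1`, since orthogonality concerns `w.ge[1]` and the extra shift lowers it to `j`.
      exact iInf₂_le (j + 1) (by simp)
    have h₂ := translate_monotone h₁ 1
    rw [translate_translate, translate_rightOrthogonal] at h₂
    simpa using h₂
  rw [w.le_eq_leftOrthogonal]
  exact fun X hX Y f hY => h' Y hY f hX

end Generation

section Main

variable {C : Type u} [Category.{v} C] [Preadditive C] [HasZeroObject C] [HasShift C ℤ]
  [∀ n : ℤ, (shiftFunctor C n).Additive] [Pretriangulated C] [IsTriangulated C]
  [HasCoproducts.{v} C]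

/-- The weight structure generated by a countably perfect class of objects `P` such that
`P[-1]` is contained in `P`. -/
def weightStructureOfPerfect (P : ObjectProperty C)
    [ObjectProperty.EssentiallySmall.{v} P] (hP : IsCountablyPerfect P)
    (hP' : P ≤ translate P 1) : WeightStructure C where
  le := bigHull P
  ge := translate P.rightOrthogonal (-1)
  le_retract := by
    rw [bigHull_eq_leftOrthogonal P hP hP']
    exact isStableUnderRetracts_leftOrthogonal _
  ge_retract := by
    rw [translate_rightOrthogonal]
    exact isStableUnderRetracts_rightOrthogonal _
  le_translate := by
    rw [bigHull_eq_leftOrthogonal P hP hP']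
    intro X hX
    refine ⟨X⟦(-1 : ℤ)⟧, fun Y f hY => ?_, ⟨(shiftEquiv C (1 : ℤ)).counitIso.app X⟩⟩
    apply (shiftFunctor C (1 : ℤ)).map_injective
    rw [Functor.map_zero]
    have hX' := P.rightOrthogonal.leftOrthogonal.prop_of_iso
      ((shiftEquiv C (1 : ℤ)).counitIso.app X).symm hX
    exact hX' _ (translate_rightOrthogonal_le hP' _ (ObjectProperty.prop_map_obj _ _ hY))
  translate_ge := by
    rw [translate_neg_translate _ (by simp)]
    have h := translate_monotone (translate_rightOrthogonal_le hP') (-1)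
    rwa [translate_neg_translate _ (by simp)] at h
  orthogonal := by
    rw [translate_neg_translate _ (by simp)]
    exact fun Y hY X f hX => bigHull_le_leftOrthogonal P X hX f hY
  exists_decomposition M := by
    obtain ⟨L, R, f, g, h, hL, hR, H⟩ := exists_orthogonal_decomposition P hP hP' M
    rw [translate_neg_translate _ (by simp)]
    exact ⟨L, R, f, g, h, ObjectProperty.le_retractClosure _ _ hL, hR, H⟩

theorem exists_weightStructure {ι : Type v} (P : ι → ObjectProperty C)
    (hP₀ : ∀ i, ObjectProperty.Small.{v} (P i)) (hP : ∀ i, IsCountablyPerfect (P i)) :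
    ∃ w : WeightStructure C, w.le = bigHull (negativeTranslates P) ∧
      w.ge = ⨅ (i : ι) (j : ℕ) (_ : 1 ≤ j), translate (P i).rightOrthogonal (-(j : ℤ)) :=
  ⟨weightStructureOfPerfect (negativeTranslates P)
    (fun J _ => isStableUnderCoproducts_nullMorphisms_iSup fun i =>
      isStableUnderCoproducts_nullMorphisms_iSup fun _ =>
        isStableUnderCoproducts_nullMorphisms_translate (hP i J) _)
    (negativeTranslates_le_translate P), rfl, translate_negativeTranslates_rightOrthogonal P⟩

theorem exists_join {ι : Type v} (W : ι → WeightStructure C)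
    (hW : ∀ i, (W i).IsPerfectlyGenerated) :
    ∃ w : WeightStructure C, w.le = bigHull (⨆ i, (W i).le) ∧ w.ge = (⨅ i, (W i).ge) ∧
      w.IsPerfectlyGenerated := by
  choose P hP₀ hP hP' using hW
  obtain ⟨w, hle, hge⟩ := exists_weightStructure P hP₀ hP
  have hge' : w.ge = ⨅ i, (W i).ge := by
    rw [hge]
    exact iInf_congr fun i => (hP' i).ge_eq.symm
  refine ⟨w, le_antisymm ?_ ?_, hge', ⨆ i, P i, inferInstance,
    fun J _ => isStableUnderCoproducts_nullMorphisms_iSup fun i => hP i J, ?_⟩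
  · rw [hle]
    exact bigHull_monotone (iSup_le fun i => iSup_le fun j =>
      ((hP' i).translate_le j).trans (le_iSup (fun i => (W i).le) i))
  -- The classes `(W i).le` need not be small, so no approximation is available for their union; it
  -- suffices that `w.ge[1]` lies in each `(W i).ge[1]`, hence is right orthogonal to every `(W
  -- i).le`.
  · rw [w.le_eq_leftOrthogonal]
    refine (bigHull_le_leftOrthogonal _).trans fun X hX Y f hY => hX f ?_
    rw [rightOrthogonal_iSup, iInf_apply, iInf_Prop_eq]
    intro i
    refine (W i).orthogonal _ (translate_monotone ?_ 1 _ hY)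
    rw [hge']
    exact iInf_le _ i
  · rw [WeightStructure.IsGeneratedBy, hge]
    simp only [rightOrthogonal_iSup, translate_iSup, translate_rightOrthogonal]
    rw [iInf_comm]
    exact iInf_congr fun j => iInf_comm

end Main

end WeightStructures

theorem mainTheorem7 {C : Type u} [Category.{v} C] [Preadditive C] [HasZeroObject C]
    [HasShift C ℤ] [∀ n : ℤ, (shiftFunctor C n).Additive] [Pretriangulated C] [IsTriangulated C]
    [HasCoproducts.{v} C] :
    -- part 1: a set of (countably) perfect sets gives a (countably) smashing weight structure
    (∀ (ι : Type v) (P : ι → ObjectProperty C), (∀ i, ObjectProperty.Small.{v} (P i)) →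
      ((∀ i, WeightStructures.IsCountablyPerfect (P i)) →
        ∃ w : WeightStructures.WeightStructure C,
          w.le = WeightStructures.bigHull
            (⨆ (i : ι) (j : ℕ), WeightStructures.translate (P i) (-(j : ℤ))) ∧
          w.ge = (⨅ (i : ι) (j : ℕ) (_ : 1 ≤ j),
            WeightStructures.translate (P i).rightOrthogonal (-(j : ℤ))) ∧
          w.IsCountablySmashing) ∧
      ((∀ i, WeightStructures.IsPerfect (P i)) →
        ∃ w : WeightStructures.WeightStructure C,
          w.le = WeightStructures.bigHull
            (⨆ (i : ι) (j : ℕ), WeightStructures.translate (P i) (-(j : ℤ))) ∧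
          w.ge = (⨅ (i : ι) (j : ℕ) (_ : 1 ≤ j),
            WeightStructures.translate (P i).rightOrthogonal (-(j : ℤ))) ∧
          w.IsSmashing)) ∧
    -- part 2: the join of a set of perfectly generated weight structures
    (∀ (ι : Type v) (W : ι → WeightStructures.WeightStructure C),
      (∀ i, (W i).IsPerfectlyGenerated) →
        ∃ w : WeightStructures.WeightStructure C,
          w.le = WeightStructures.bigHull (⨆ i, (W i).le) ∧
          w.ge = (⨅ i, (W i).ge) ∧
          w.IsPerfectlyGenerated ∧
          ((∀ i, (W i).IsSmashing) → w.IsSmashing)) := by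
  refine ⟨fun ι P hP₀ => ⟨fun hP => ?_, fun hP => ?_⟩, fun ι W hW => ?_⟩
  · obtain ⟨w, hle, hge⟩ := WeightStructures.exists_weightStructure P hP₀ hP
    refine ⟨w, hle, hge, fun J _ => ?_⟩
    rw [hge]
    exact WeightStructures.isClosedUnderCoproducts_iInf_translate fun i => hP i J
  · obtain ⟨w, hle, hge⟩ :=
      WeightStructures.exists_weightStructure P hP₀ fun i => (hP i).isCountablyPerfect
    refine ⟨w, hle, hge, fun J => ?_⟩
    rw [hge]
    exact WeightStructures.isClosedUnderCoproducts_iInf_translate fun i => hP i J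
  · obtain ⟨w, hle, hge, hw⟩ := WeightStructures.exists_join W hW
    refine ⟨w, hle, hge, hw, fun h J => ?_⟩
    rw [hge]
    exact WeightStructures.isClosedUnderColimitsOfShape_iInf fun i => h i J
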